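/- Consider the initial value problem $s' = c^3$, $c' = -s^3$, $s(0)=0$, $c(0)=1$ for holomorphic functions of a complex variable; it has a solution pair in the disc $|z|<2^2/3^3$. Let $\wp$ be the (lemniscatic) Weierstrass elliptic function with invariants $g_2 = 1$ and $g_3 = 0$ (a period lattice with these invariants exists). If $(s,c)$ is a solution pair in a connected open set $U\subseteq\mathbb{C}$ containing $0$ (for instance in that disc), then the square $S = s^2$ is given on $U$ by $$S = \frac{\wp}{\wp^2 + 1/4}.$$ That is, $\wp(z)^2+\tfrac14\neq 0$ and $s(z)^2 = \wp(z)/(\wp(z)^2+\tfrac14)$ for every $z\in U$ that is not a pole of $\wp$, and $s(z)^2=0$ (the value of the right-hand side at its removable singularity) for every $z \in U$ that is a pole of $\wp$. In particular $S$ extends from $U$ to the elliptic function $\wp/(\wp^2+1/4)$, which is meromorphic on $\mathbb{C}$ and has all the periods of $\wp$. -/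

import Mathlib

/-- `s` and `c` solve, on the set `U` of complex numbers, the initial value problem
`s' = c ^ 3`, `c' = -s ^ 3`, `s 0 = 0`, `c 0 = 1` (complex derivatives). -/
structure IsIVPSolutionOn (s c : ℂ → ℂ) (U : Set ℂ) : Prop where
  hasDerivAt_s : ∀ z ∈ U, HasDerivAt s (c z ^ 3) z
  hasDerivAt_c : ∀ z ∈ U, HasDerivAt c (-(s z ^ 3)) z
  s_zero : s 0 = 0
  c_zero : c 0 = 1

/-! Both `1/℘` and `q = 2s²/(1 + c²)` solve `y'' = 2 - (3/2)y²` near `0` and vanish there to order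
at least two. For `1/℘` this follows from `℘'² = 4℘³ - ℘`; for `q` from the first integral `s⁴ + c⁴
= 1`. A nonzero difference of two such solutions would have a second derivative of too low an order,
so `℘ = (1 + c²)/(2s²)` near `0`, and the first integral turns this into `s²(℘² + 1/4) = ℘`. The
identity theorem for meromorphic functions carries this relation over the connected set `U`; limits
then give the values at ordinary points and at poles.

Existence of `(s, c)` is Picard iteration. Existence of the lattice comes from rescaling the
Gaussian integers, whose symmetry under `I` forces `g₃ = 0`. -/

/-! ### Local existence for the initial value problem -/

open Metric Filter Topology in
/-- **Cauchy's existence theorem** for autonomous holomorphic differential equations: the solution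
with initial value `x₀` exists on every disc of radius `r` with `M * r ≤ b` and `K * r ≤ 1`, where
`M` bounds the vector field and `K` is a Lipschitz constant for it on the ball of radius `b`. -/
theorem exists_forall_mem_ball_hasDerivAt_of_lipschitzOn {E : Type*} [NormedAddCommGroup E]
    [NormedSpace ℂ E] [CompleteSpace E] {V : E → E} {x₀ : E} {b M K r : ℝ} (hb : 0 ≤ b)
    (hK : 0 < K) (hV : DifferentiableOn ℂ V (closedBall x₀ b))
    (hM : ∀ x ∈ closedBall x₀ b, ‖V x‖ ≤ M)
    (hL : ∀ x ∈ closedBall x₀ b, ∀ y ∈ closedBall x₀ b, ‖V x - V y‖ ≤ K * ‖x - y‖)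
    (hMr : M * r ≤ b) (hKr : K * r ≤ 1) :
    ∃ u : ℂ → E, u 0 = x₀ ∧ ∀ z ∈ ball (0 : ℂ) r, HasDerivAt u (V (u z)) z := by
  have hM0 : 0 ≤ M := (norm_nonneg _).trans (hM x₀ (mem_closedBall_self hb))
  let X := {u : ℂ → E // u 0 = x₀ ∧ DifferentiableOn ℂ u (ball 0 r) ∧
    ∀ z ∈ ball (0 : ℂ) r, u z ∈ closedBall x₀ b}
  have key : ∀ z ∈ ball (0 : ℂ) r, closedBall (0 : ℂ) ‖z‖ ⊆ ball 0 r := fun z hz =>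
    closedBall_subset_ball (by simpa using hz)
  -- The Picard operator: holomorphic functions on a disc have primitives, and `M * r ≤ b` keeps the
  -- new iterate in the ball.
  have step : ∀ u : X, ∃ v : X, ∀ z ∈ ball (0 : ℂ) r, HasDerivAt v.1 (V (u.1 z)) z := by
    rintro ⟨u, -, hu, hub⟩
    obtain ⟨v, hv0, hv⟩ := ((hV.comp hu hub).isExactOn_ball).with_val_at 0 x₀
    refine ⟨⟨v, hv0, fun z hz => (hv z hz).differentiableAt.differentiableWithinAt,
      fun z hz => ?_⟩, hv⟩
    have h := (convex_closedBall (0 : ℂ) ‖z‖).norm_image_sub_le_of_norm_hasDerivWithin_le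
      (f := v) (C := M) (fun w hw => (hv w (key z hz hw)).hasDerivWithinAt)
      (fun w hw => hM _ (hub w (key z hz hw))) (x := 0) (y := z) (by simp) (by simp)
    rw [hv0, sub_zero] at h
    rw [mem_closedBall, dist_eq_norm]
    have hz' : ‖z‖ < r := by simpa using hz
    exact h.trans ((mul_le_mul_of_nonneg_left hz'.le hM0).trans hMr)
  choose T hT using step
  let x : X := ⟨fun _ => x₀, rfl, differentiableOn_const _, fun _ _ => mem_closedBall_self hb⟩
  let u : ℕ → X := fun n => T^[n] x
  have hu : ∀ n, ∀ z ∈ ball (0 : ℂ) r, HasDerivAt (u (n + 1)).1 (V ((u n).1 z)) z := by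
    intro n
    simpa only [u, Function.iterate_succ_apply'] using hT (u n)
  -- The mean value inequality on the disc of radius `‖z‖` gains a factor `K * ‖z‖ < 1` at each
  -- step; the ratio is uniform only on smaller discs.
  have hdist : ∀ n, ∀ z ∈ ball (0 : ℂ) r,
      dist ((u n).1 z) ((u (n + 1)).1 z) ≤ b * (K * ‖z‖) ^ n := by
    intro n
    induction n with
    | zero =>
      intro z hz
      simpa [u, x, dist_comm] using (u 1).2.2.2 z hz
    | succ n ih =>
      intro z hz
      have h := (convex_closedBall (0 : ℂ) ‖z‖).norm_image_sub_le_of_norm_hasDerivWithin_le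
        (f := fun w => (u (n + 1)).1 w - (u (n + 2)).1 w) (C := K * (b * (K * ‖z‖) ^ n))
        (fun w hw => ((hu n w (key z hz hw)).sub (hu (n + 1) w (key z hz hw))).hasDerivWithinAt)
        (fun w hw => ?_) (x := 0) (y := z) (by simp) (by simp)
      · simp only [(u (n + 1)).2.1, (u (n + 2)).2.1, sub_self, sub_zero] at h
        rw [dist_eq_norm]
        exact h.trans_eq (by ring)
      · have hw' : ‖w‖ ≤ ‖z‖ := by simpa using hw
        refine (hL _ ((u n).2.2.2 w (key z hz hw)) _ ((u (n + 1)).2.2.2 w (key z hz hw))).trans ?_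
        refine mul_le_mul_of_nonneg_left ?_ hK.le
        rw [← dist_eq_norm]
        refine (ih w (key z hz hw)).trans ?_
        gcongr
  have hlt : ∀ ρ < r, K * ρ < 1 := fun ρ hρ => (mul_lt_mul_of_pos_left hρ hK).trans_le hKr
  have hlim : ∀ z, ∃ a, z ∈ ball (0 : ℂ) r → Tendsto (fun n => (u n).1 z) atTop (𝓝 a) := by
    intro z
    by_cases hz : z ∈ ball (0 : ℂ) r
    · obtain ⟨a, ha⟩ := cauchySeq_tendsto_of_complete
        (cauchySeq_of_le_geometric (K * ‖z‖) b (hlt _ (by simpa using hz))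
          fun n => hdist n z hz)
      exact ⟨a, fun _ => ha⟩
    · exact ⟨0, fun h => absurd h hz⟩
  choose v hv using hlim
  have hunif : TendstoLocallyUniformlyOn (fun n => (u n).1) v atTop (ball (0 : ℂ) r) := by
    rw [Metric.tendstoLocallyUniformlyOn_iff]
    intro ε hε z hz
    obtain ⟨ρ, hzρ, hρ⟩ := exists_between (show ‖z‖ < r by simpa using hz)
    have hρ0 : 0 ≤ ρ := (norm_nonneg z).trans hzρ.le
    refine ⟨ball 0 ρ, mem_nhdsWithin_of_mem_nhds (isOpen_ball.mem_nhds (by simpa using hzρ)), ?_⟩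
    have htend : Tendsto (fun n : ℕ => b * (K * ρ) ^ n / (1 - K * ρ)) atTop (𝓝 0) := by
      simpa using ((tendsto_pow_atTop_nhds_zero_of_lt_one (by positivity)
        (hlt ρ hρ)).const_mul b).div_const (1 - K * ρ)
    filter_upwards [htend.eventually_lt_const hε] with n hn w hw
    have hw' : ‖w‖ < ρ := by simpa using hw
    have hwr : w ∈ ball (0 : ℂ) r := by simpa using hw'.trans hρ
    rw [dist_comm]
    refine (dist_le_of_le_geometric_of_tendsto (K * ρ) b (hlt ρ hρ) (fun n => ?_)
      (hv w hwr) n).trans_lt hn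
    refine (hdist n w hwr).trans ?_
    gcongr
  have hdiff : ∀ᶠ n in atTop, DifferentiableOn ℂ (u n).1 (ball (0 : ℂ) r) :=
    Eventually.of_forall fun n => (u n).2.2.1
  -- The update matters only when `r ≤ 0`: the disc is then empty and `v 0` is arbitrary.
  refine ⟨Function.update v 0 x₀, by simp, fun z hz => ?_⟩
  have hv0 : Function.update v 0 x₀ = v := by
    refine Function.update_eq_self_iff.2 ?_
    have h0 := hv 0 (mem_ball_self (pos_of_mem_ball hz))
    simp only [(u _).2.1] at h0
    exact tendsto_nhds_unique tendsto_const_nhds h0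
  rw [hv0]
  have hvz : v z ∈ closedBall x₀ b :=
    isClosed_closedBall.mem_of_tendsto (hv z hz) (.of_forall fun n => (u n).2.2.2 z hz)
  have h1 : Tendsto (fun n => deriv (u (n + 1)).1 z) atTop (𝓝 (deriv v z)) :=
    ((hunif.deriv hdiff isOpen_ball).tendsto_at hz).comp (tendsto_add_atTop_nat 1)
  have h2 : Tendsto (fun n => V ((u n).1 z)) atTop (𝓝 (V (v z))) :=
    (hV.continuousOn _ hvz).tendsto.comp
      (tendsto_nhdsWithin_iff.2 ⟨hv z hz, .of_forall fun n => (u n).2.2.2 z hz⟩)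
  have h3 : deriv v z = V (v z) :=
    tendsto_nhds_unique (h1.congr fun n => (hu n z hz).deriv) h2
  rw [← h3]
  exact ((hunif.differentiableOn hdiff isOpen_ball).differentiableAt
    (isOpen_ball.mem_nhds hz)).hasDerivAt

/-- Cubing is Lipschitz with constant `27 / 4` on the disc of radius `3 / 2`. -/
theorem norm_pow_three_sub_pow_three_le {x y : ℂ} (hx : ‖x‖ ≤ 3 / 2) (hy : ‖y‖ ≤ 3 / 2) :
    ‖x ^ 3 - y ^ 3‖ ≤ 27 / 4 * ‖x - y‖ := by
  rw [show x ^ 3 - y ^ 3 = (x ^ 2 + x * y + y ^ 2) * (x - y) by ring, norm_mul]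
  refine mul_le_mul_of_nonneg_right (norm_add₃_le.trans ?_) (norm_nonneg _)
  rw [norm_pow, norm_pow, norm_mul]
  nlinarith [norm_nonneg x, norm_nonneg y, mul_le_mul hx hy (norm_nonneg y) (by norm_num)]

theorem exists_isIVPSolutionOn_ball :
    ∃ s c : ℂ → ℂ, IsIVPSolutionOn s c (Metric.ball 0 (2 ^ 2 / 3 ^ 3)) := by
  have hbound : ∀ x ∈ Metric.closedBall ((0, 1) : ℂ × ℂ) (1 / 2), ‖x.1‖ ≤ 3 / 2 ∧ ‖x.2‖ ≤ 3 / 2 := by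
    intro x hx
    rw [mem_closedBall_iff_norm, Prod.norm_def, max_le_iff] at hx
    simp only [Prod.fst_sub, Prod.snd_sub, sub_zero] at hx
    refine ⟨by linarith, ?_⟩
    have := norm_le_norm_sub_add x.2 1
    rw [norm_one] at this
    linarith
  have hcube : ∀ x : ℂ, ‖x‖ ≤ 3 / 2 → ‖x ^ 3‖ ≤ 27 / 8 := fun x hx => by
    rw [norm_pow]
    exact (pow_le_pow_left₀ (norm_nonneg x) hx 3).trans (by norm_num)
  -- `M = (3/2)³` and `K = 3 * (3/2)²`; with `b = 1/2`, both radius conditions are equalities at `r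
  -- = 4/27`.
  obtain ⟨u, hu0, hu⟩ := exists_forall_mem_ball_hasDerivAt_of_lipschitzOn
    (V := fun x : ℂ × ℂ => (x.2 ^ 3, -(x.1 ^ 3))) (x₀ := (0, 1)) (b := 1 / 2) (M := 27 / 8)
    (K := 27 / 4) (r := 2 ^ 2 / 3 ^ 3) (by norm_num) (by norm_num)
    (by fun_prop)
    (fun x hx => by
      rw [Prod.norm_def, norm_neg]
      exact max_le (hcube _ (hbound x hx).2) (hcube _ (hbound x hx).1))
    (fun x hx y hy => by
      rw [Prod.norm_def]
      simp only [Prod.fst_sub, Prod.snd_sub]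
      refine max_le ((norm_pow_three_sub_pow_three_le (hbound x hx).2 (hbound y hy).2).trans ?_) ?_
      · exact mul_le_mul_of_nonneg_left (norm_snd_le (x - y)) (by norm_num)
      · rw [neg_sub_neg, norm_sub_rev]
        exact (norm_pow_three_sub_pow_three_le (hbound x hx).1 (hbound y hy).1).trans
          (mul_le_mul_of_nonneg_left (norm_fst_le (x - y)) (by norm_num)))
    (by norm_num) (by norm_num)
  refine ⟨fun z => (u z).1, fun z => (u z).2, fun z hz => ?_, fun z hz => ?_, by simp [hu0],
    by simp [hu0]⟩
  · exact hasFDerivAt_fst.comp_hasDerivAt z (hu z hz)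
  · exact hasFDerivAt_snd.comp_hasDerivAt z (hu z hz)
-- The lattice with invariants 1 and 0
open Filter Topology

namespace PeriodPair

variable (L : PeriodPair)

/-- The invariants `g₂` and `g₃` of a lattice do not both vanish: otherwise `℘' ^ 2 = 4 * ℘ ^ 3`,
which is impossible at a zero of `℘'`, by comparing orders of vanishing. -/
theorem g₂_ne_zero_of_g₃_eq_zero (h3 : L.g₃ = 0) : L.g₂ ≠ 0 := by
  intro h2
  set w := L.ω₁ / 2 with hw
  have hwL : w ∉ L.lattice := L.ω₁_div_two_notMem_lattice
  -- `℘'` is odd and periodic, hence vanishes at a half period.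
  have hd : L.derivWeierstrassP w = 0 := by
    have h := L.derivWeierstrassP_add_coe (-w) ⟨L.ω₁, L.ω₁_mem_lattice⟩
    rw [L.derivWeierstrassP_neg] at h
    have hww : -w + L.ω₁ = w := by rw [hw]; ring
    simp only [hww] at h
    exact CharZero.eq_neg_self_iff.1 h
  have heq : ∀ z ∉ L.lattice, L.derivWeierstrassP z ^ 2 = 4 * L.weierstrassP z ^ 3 := by
    intro z hz
    rw [L.derivWeierstrassP_sq z hz, h2, h3]
    ring
  have hP : L.weierstrassP w = 0 := by
    have := heq w hwL
    simpa [hd] using this.symm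
  have han : AnalyticAt ℂ L.weierstrassP w := L.analyticOnNhd_weierstrassP w hwL
  have htop : meromorphicOrderAt L.weierstrassP w ≠ ⊤ :=
    (L.meromorphic_weierstrassP.exists_meromorphicOrderAt_ne_top_iff_forall).1
      ⟨0, by rw [L.order_weierstrassP 0 L.lattice.zero_mem]; exact WithTop.coe_ne_top⟩ w
  obtain ⟨n, hn⟩ := WithTop.ne_top_iff_exists.1 htop
  have hpos : 0 < meromorphicOrderAt L.weierstrassP w := by
    rw [← tendsto_zero_iff_meromorphicOrderAt_pos (L.meromorphic_weierstrassP w), ← hP]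
    exact han.continuousAt.tendsto.mono_left nhdsWithin_le_nhds
  rw [← hn] at hpos
  have hn0 : 0 < n := by exact_mod_cast hpos
  have hderiv : meromorphicOrderAt L.derivWeierstrassP w = ((n - 1 : ℤ) : WithTop ℤ) := by
    rw [← L.deriv_weierstrassP]
    exact meromorphicOrderAt_deriv_eq_sub_one (by exact_mod_cast hn0.ne') hn.symm
  have hev : (fun z => L.derivWeierstrassP z ^ 2) =ᶠ[𝓝[≠] w]
      fun z => 4 * L.weierstrassP z ^ 3 := by
    filter_upwards [nhdsWithin_le_nhds (L.isClosed_lattice.isOpen_compl.mem_nhds hwL)] with z hz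
    exact heq z hz
  have h4 : meromorphicOrderAt (fun _ : ℂ => (4 : ℂ)) w = 0 := by
    rw [meromorphicOrderAt_const, if_neg (by norm_num)]
  have hord := meromorphicOrderAt_congr hev
  rw [fun_meromorphicOrderAt_pow (L.meromorphic_derivWeierstrassP w),
    fun_meromorphicOrderAt_mul (by fun_prop) ((L.meromorphic_weierstrassP w).fun_pow 3),
    fun_meromorphicOrderAt_pow (L.meromorphic_weierstrassP w), h4, hderiv, ← hn] at hord
  have hn' : 2 * (n - 1) = 3 * n := by
    refine WithTop.coe_injective ?_
    rw [WithTop.coe_mul, WithTop.coe_mul]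
    simpa using hord
  omega

/-- The period pair scaled by a nonzero complex number. -/
noncomputable def smul (a : ℂ) (ha : a ≠ 0) : PeriodPair where
  ω₁ := a * L.ω₁
  ω₂ := a * L.ω₂
  indep := by
    rw [LinearIndependent.pair_iff]
    intro s t h
    refine LinearIndependent.pair_iff.1 L.indep s t (mul_left_cancel₀ ha ?_)
    rw [mul_zero, ← h, mul_add, mul_smul_comm, mul_smul_comm]

theorem mem_lattice_smul {a : ℂ} (ha : a ≠ 0) {x : ℂ} :
    a * x ∈ (L.smul a ha).lattice ↔ x ∈ L.lattice := by
  simp only [mem_lattice, smul]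
  refine exists₂_congr fun m n => ?_
  rw [← mul_right_inj' (b := m * L.ω₁ + n * L.ω₂) ha, mul_add, mul_left_comm a, mul_left_comm a]

theorem G_eq_of_forall_mem_lattice {L L' : PeriodPair} {a : ℂ} (ha : a ≠ 0)
    (h : ∀ x, a * x ∈ L'.lattice ↔ x ∈ L.lattice) (n : ℕ) : L'.G n = (a ^ n)⁻¹ * L.G n := by
  let e : L.lattice ≃ L'.lattice := (Equiv.mulLeft₀ a ha).subtypeEquiv fun x => (h x).symm
  rw [G, ← e.tsum_eq, G, ← tsum_mul_left]
  refine tsum_congr fun l => ?_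
  change ((a * (l : ℂ)) ^ n)⁻¹ = _
  rw [mul_pow, mul_inv]

/-- The period pair `(1, I)` of the Gaussian integers. -/
noncomputable def gaussian : PeriodPair where
  ω₁ := 1
  ω₂ := Complex.I
  indep := by
    rw [LinearIndependent.pair_iff]
    intro s t h
    have hre := congrArg Complex.re h
    have him := congrArg Complex.im h
    simpa using And.intro hre him

theorem I_mul_mem_lattice_gaussian (x : ℂ) :
    Complex.I * x ∈ gaussian.lattice ↔ x ∈ gaussian.lattice := by
  have key : ∀ y ∈ gaussian.lattice, Complex.I * y ∈ gaussian.lattice := by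
    intro y hy
    obtain ⟨m, n, rfl⟩ := mem_lattice.1 hy
    refine mem_lattice.2 ⟨-n, m, ?_⟩
    simp only [gaussian]
    push_cast
    linear_combination (-(n : ℂ)) * Complex.I_mul_I
  refine ⟨fun h => ?_, key x⟩
  have := gaussian.lattice.neg_mem (key _ h)
  rwa [← mul_assoc, Complex.I_mul_I, neg_one_mul, neg_neg] at this

/-- Rotation by `I` preserves the lattice and multiplies the weight 6 sum by `I⁻⁶ = -1`. -/
theorem g₃_gaussian : gaussian.g₃ = 0 := by
  have h := G_eq_of_forall_mem_lattice Complex.I_ne_zero I_mul_mem_lattice_gaussian 6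
  have hI : (Complex.I ^ 6)⁻¹ = -1 := by
    rw [show Complex.I ^ 6 = Complex.I ^ 4 * Complex.I ^ 2 by ring, Complex.I_pow_four,
      Complex.I_sq]
    norm_num
  rw [hI, neg_one_mul, CharZero.eq_neg_self_iff] at h
  rw [g₃, h, mul_zero]

theorem exists_g₂_eq_one_g₃_eq_zero : ∃ L : PeriodPair, L.g₂ = 1 ∧ L.g₃ = 0 := by
  have hg := gaussian.g₂_ne_zero_of_g₃_eq_zero g₃_gaussian
  -- Scaling the lattice by `a` divides `g₂` by `a ^ 4`.
  obtain ⟨a, ha⟩ := IsAlgClosed.exists_pow_nat_eq gaussian.g₂ (n := 4) (by norm_num)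
  have ha0 : a ≠ 0 := by
    rintro rfl
    exact hg (by rw [← ha]; norm_num)
  have hG := G_eq_of_forall_mem_lattice ha0 fun x => gaussian.mem_lattice_smul ha0 (x := x)
  refine ⟨gaussian.smul a ha0, ?_, ?_⟩
  · rw [g₂, hG, mul_left_comm, ← g₂, ha, inv_mul_cancel₀ hg]
  · rw [g₃, hG, mul_left_comm, ← g₃, g₃_gaussian, mul_zero]

end PeriodPair

/-! ### Uniqueness for the second-order equation, and `1/℘` as a solution -/

/-- Two meromorphic solutions of `y'' = a + b * y ^ 2` that vanish to order at least two at `x`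
agree near `x`. -/
theorem eventuallyEq_nhdsNE_of_hasDerivAt_quadratic {f f' g g' : ℂ → ℂ} {a b x : ℂ}
    (hf : MeromorphicAt f x) (hg : MeromorphicAt g x)
    (hf2 : 2 ≤ meromorphicOrderAt f x) (hg2 : 2 ≤ meromorphicOrderAt g x)
    (hf' : ∀ᶠ z in 𝓝[≠] x, HasDerivAt f (f' z) z)
    (hf'' : ∀ᶠ z in 𝓝[≠] x, HasDerivAt f' (a + b * f z ^ 2) z)
    (hg' : ∀ᶠ z in 𝓝[≠] x, HasDerivAt g (g' z) z)
    (hg'' : ∀ᶠ z in 𝓝[≠] x, HasDerivAt g' (a + b * g z ^ 2) z) :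
    f =ᶠ[𝓝[≠] x] g := by
  have hord : meromorphicOrderAt (f - g) x = ⊤ := by
    by_contra htop
    obtain ⟨n, hn⟩ := WithTop.ne_top_iff_exists.1 htop
    have hn2 : (2 : WithTop ℤ) ≤ n := by
      rw [hn, sub_eq_add_neg]
      refine le_trans (le_min hf2 ?_) (meromorphicOrderAt_add hf hg.neg)
      rwa [← meromorphicOrderAt_neg]
    have hn2' : 2 ≤ n := WithTop.coe_le_coe.1 (show ((2 : ℤ) : WithTop ℤ) ≤ n from hn2)
    -- As `n ≥ 2`, neither `n` nor `n - 1` is zero, so two differentiations lower the order to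
    -- exactly `n - 2`. But `(f - g)'' = b(f + g)(f - g)` has order at least `n`.
    have h1 : meromorphicOrderAt (f' - g') x = ((n - 1 : ℤ) : WithTop ℤ) := by
      rw [← meromorphicOrderAt_deriv_eq_sub_one (Int.cast_ne_zero.2 (by omega)) hn.symm]
      refine meromorphicOrderAt_congr ?_
      filter_upwards [hf', hg'] with z h h'
      exact (h.sub h').deriv.symm
    have h2 : meromorphicOrderAt ((fun z => b * (f z + g z)) * (f - g)) x
        = ((n - 1 - 1 : ℤ) : WithTop ℤ) := by
      rw [← meromorphicOrderAt_deriv_eq_sub_one (Int.cast_ne_zero.2 (by omega)) h1]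
      refine meromorphicOrderAt_congr ?_
      filter_upwards [hf'', hg''] with z h h'
      rw [(h.sub h').deriv]
      simp only [Pi.mul_apply, Pi.sub_apply]
      ring
    have hsum : 0 ≤ meromorphicOrderAt (fun z => b * (f z + g z)) x := by
      rw [fun_meromorphicOrderAt_mul (by fun_prop) (hf.fun_add hg)]
      refine add_nonneg analyticAt_const.meromorphicOrderAt_nonneg ?_
      exact le_trans (le_min (le_trans (by norm_num) hf2) (le_trans (by norm_num) hg2))
        (meromorphicOrderAt_add hf hg)
    rw [meromorphicOrderAt_mul (by fun_prop) (hf.sub hg), ← hn] at h2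
    have h3 : (n : WithTop ℤ) ≤ ((n - 1 - 1 : ℤ) : WithTop ℤ) := by
      rw [← h2]
      exact le_add_of_nonneg_left hsum
    have h4 : n ≤ n - 1 - 1 := by exact_mod_cast h3
    omega
  filter_upwards [meromorphicOrderAt_eq_top_iff.1 hord] with z hz
  exact sub_eq_zero.1 hz

namespace PeriodPair

variable (L : PeriodPair)

theorem eventually_nhdsNE_notMem_lattice (x : ℂ) : ∀ᶠ z in 𝓝[≠] x, z ∉ L.lattice := by
  filter_upwards [nhdsWithin_le_nhds (L.compl_lattice_sdiff_singleton_mem_nhds x),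
    self_mem_nhdsWithin] with z hz hzx h
  exact hz ⟨h, hzx⟩

theorem hasDerivAt_weierstrassP {z : ℂ} (hz : z ∉ L.lattice) :
    HasDerivAt L.weierstrassP (L.derivWeierstrassP z) z := by
  rw [← L.deriv_weierstrassP]
  exact (L.analyticOnNhd_weierstrassP z hz).differentiableAt.hasDerivAt

/-- Differentiate the cubic equation for `℘'²` and cancel `2℘'`; this is where `℘' ≠ 0` enters. -/
theorem hasDerivAt_derivWeierstrassP {z : ℂ} (hz : z ∉ L.lattice)
    (h0 : L.derivWeierstrassP z ≠ 0) :
    HasDerivAt L.derivWeierstrassP (6 * L.weierstrassP z ^ 2 - L.g₂ / 2) z := by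
  have h := (L.analyticOnNhd_derivWeierstrassP z hz).differentiableAt.hasDerivAt
  have hP := L.hasDerivAt_weierstrassP hz
  have h1 := h.fun_pow 2
  have h2 := (((hP.fun_pow 3).const_mul 4).sub (hP.const_mul L.g₂)).sub_const L.g₃
  have h3 := h1.unique (h2.congr_of_eventuallyEq (by
    filter_upwards [L.isClosed_lattice.isOpen_compl.mem_nhds hz] with w hw
    exact L.derivWeierstrassP_sq w hw))
  refine h.congr_deriv (mul_left_cancel₀ (mul_ne_zero two_ne_zero h0) ?_)
  norm_num at h3
  linear_combination h3

theorem eventually_hasDerivAt_inv_weierstrassP (h2 : L.g₂ = 1) (h3 : L.g₃ = 0) :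
    ∀ᶠ z in 𝓝[≠] (0 : ℂ),
      HasDerivAt (fun w => (L.weierstrassP w)⁻¹)
        (-L.derivWeierstrassP z / L.weierstrassP z ^ 2) z ∧
      HasDerivAt (fun w => -L.derivWeierstrassP w / L.weierstrassP w ^ 2)
        (2 + (-3 / 2) * (L.weierstrassP z)⁻¹ ^ 2) z := by
  have hord := L.order_weierstrassP 0 L.lattice.zero_mem
  have hne : ∀ᶠ z in 𝓝[≠] (0 : ℂ), L.weierstrassP z ≠ 0 :=
    (meromorphicOrderAt_ne_top_iff_eventually_ne_zero (L.meromorphic_weierstrassP 0)).1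
      (by rw [hord]; exact WithTop.coe_ne_top)
  have hne' : ∀ᶠ z in 𝓝[≠] (0 : ℂ), L.derivWeierstrassP z ≠ 0 := by
    refine (meromorphicOrderAt_ne_top_iff_eventually_ne_zero (L.meromorphic_derivWeierstrassP 0)).1
      ?_
    rw [← L.deriv_weierstrassP, meromorphicOrderAt_deriv_eq_sub_one (n := -2) (by norm_num) hord]
    exact WithTop.coe_ne_top
  filter_upwards [L.eventually_nhdsNE_notMem_lattice 0, hne, hne'] with z hz hP hP'
  have hd := L.hasDerivAt_weierstrassP hz
  have hd' := L.hasDerivAt_derivWeierstrassP hz hP'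
  refine ⟨hd.fun_inv hP, ?_⟩
  refine (hd'.fun_neg.fun_div (hd.fun_pow 2) (pow_ne_zero 2 hP)).congr_deriv ?_
  have hsq := L.derivWeierstrassP_sq z hz
  rw [h2, h3] at hsq
  rw [h2]
  field_simp
  norm_num
  linear_combination 4 * L.weierstrassP z * hsq

end PeriodPair

/-! ### Comparison of the solution pair with `℘` -/

namespace IsIVPSolutionOn

variable {s c : ℂ → ℂ} {U : Set ℂ}

theorem eventually_pow_four_add_pow_four (h : IsIVPSolutionOn s c U) (hU : U ∈ 𝓝 0) :
    ∀ᶠ z in 𝓝 (0 : ℂ), s z ^ 4 + c z ^ 4 = 1 := by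
  obtain ⟨r, hr, hrU⟩ := Metric.mem_nhds_iff.1 hU
  have hd : ∀ z ∈ Metric.ball (0 : ℂ) r, HasDerivAt (fun w => s w ^ 4 + c w ^ 4) 0 z := by
    intro z hz
    convert! ((h.hasDerivAt_s z (hrU hz)).fun_pow 4).add ((h.hasDerivAt_c z (hrU hz)).fun_pow 4)
      using 1
    norm_num
    ring
  filter_upwards [Metric.ball_mem_nhds (0 : ℂ) hr] with z hz
  have := (convex_ball (0 : ℂ) r).norm_image_sub_le_of_norm_hasDerivWithin_le (C := 0)
    (fun w hw => (hd w hw).hasDerivWithinAt) (by simp) (Metric.mem_ball_self hr) hz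
  simpa [h.s_zero, h.c_zero, sub_eq_zero] using this

/-- Solving `s² = ℘/(℘² + 1/4)` for `1/℘`, with `√(1 - s⁴) = c²`, gives `2(1 - c²)/s²` as the root
vanishing at `0`. The form `2s²/(1 + c²)` avoids the quotient `0/0` there. -/
theorem eventually_hasDerivAt_sq_div (h : IsIVPSolutionOn s c U) (hU : IsOpen U) (h0 : 0 ∈ U) :
    ∀ᶠ z in 𝓝 (0 : ℂ), 1 + c z ^ 2 ≠ 0 ∧ s z ^ 4 + c z ^ 4 = 1 ∧
      HasDerivAt (fun w => 2 * s w ^ 2 / (1 + c w ^ 2)) (4 * (s z * c z) / (1 + c z ^ 2)) z ∧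
      HasDerivAt (fun w => 4 * (s w * c w) / (1 + c w ^ 2))
        (2 + (-3 / 2) * (2 * s z ^ 2 / (1 + c z ^ 2)) ^ 2) z := by
  have hne : ∀ᶠ z in 𝓝 (0 : ℂ), 1 + c z ^ 2 ≠ 0 := by
    have hc : ContinuousAt (fun z => 1 + c z ^ 2) 0 :=
      continuousAt_const.add ((h.hasDerivAt_c 0 h0).continuousAt.pow 2)
    exact hc.eventually_ne (by norm_num [h.c_zero])
  filter_upwards [hne, h.eventually_pow_four_add_pow_four (hU.mem_nhds h0), hU.mem_nhds h0]
    with z hz hsc hzU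
  have hs := h.hasDerivAt_s z hzU
  have hc := h.hasDerivAt_c z hzU
  have hden := (hc.fun_pow 2).const_add 1
  refine ⟨hz, hsc, ?_, ?_⟩
  · refine (((hs.fun_pow 2).const_mul 2).fun_div hden hz).congr_deriv ?_
    rw [div_eq_div_iff (pow_ne_zero 2 hz) hz]
    norm_num
    linear_combination (4 * s z * c z * (1 + c z ^ 2)) * hsc
  · refine (((hs.fun_mul hc).const_mul 4).fun_div hden hz).congr_deriv ?_
    rw [div_eq_iff (pow_ne_zero 2 hz), div_pow]
    norm_num
    field_simp
    linear_combination (2 + 4 * c z ^ 2) * hsc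

theorem analyticAt (h : IsIVPSolutionOn s c U) (hU : IsOpen U) {z : ℂ} (hz : z ∈ U) :
    AnalyticAt ℂ s z ∧ AnalyticAt ℂ c z :=
  ⟨DifferentiableOn.analyticAt (fun w hw =>
      (h.hasDerivAt_s w hw).differentiableAt.differentiableWithinAt) (hU.mem_nhds hz),
    DifferentiableOn.analyticAt (fun w hw =>
      (h.hasDerivAt_c w hw).differentiableAt.differentiableWithinAt) (hU.mem_nhds hz)⟩

theorem eventually_inv_weierstrassP_eq (h : IsIVPSolutionOn s c U) (hU : IsOpen U) (h0 : 0 ∈ U)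
    {L : PeriodPair} (h2 : L.g₂ = 1) (h3 : L.g₃ = 0) :
    ∀ᶠ z in 𝓝[≠] (0 : ℂ), (L.weierstrassP z)⁻¹ = 2 * s z ^ 2 / (1 + c z ^ 2) := by
  obtain ⟨hs, hc⟩ := h.analyticAt hU h0
  have hden : (1 : ℂ) + c 0 ^ 2 ≠ 0 := by norm_num [h.c_zero]
  have hq : AnalyticAt ℂ (fun w => 2 / (1 + c w ^ 2)) 0 :=
    analyticAt_const.fun_div (by fun_prop) hden
  have hs1 : 1 ≤ meromorphicOrderAt s 0 := by
    have hpos : 0 < meromorphicOrderAt s 0 := by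
      rw [← tendsto_zero_iff_meromorphicOrderAt_pos hs.meromorphicAt, ← h.s_zero]
      simpa only [h.s_zero] using hs.continuousAt.tendsto.mono_left nhdsWithin_le_nhds
    cases hn : meromorphicOrderAt s 0 with
    | top => exact le_top
    | coe n =>
      rw [hn] at hpos
      exact WithTop.coe_le_coe.2 (Int.add_one_le_iff.2 (WithTop.coe_lt_coe.1 hpos))
  have heq : (fun w => 2 * s w ^ 2 / (1 + c w ^ 2)) = (s * s) * fun w => 2 / (1 + c w ^ 2) := by
    funext w
    simp only [Pi.mul_apply]
    ring
  have hev := (h.eventually_hasDerivAt_sq_div hU h0).filter_mono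
    (nhdsWithin_le_nhds (s := {0}ᶜ))
  have hev' := L.eventually_hasDerivAt_inv_weierstrassP h2 h3
  refine eventuallyEq_nhdsNE_of_hasDerivAt_quadratic (L.meromorphic_weierstrassP 0).fun_inv ?_ ?_ ?_
    (hev'.mono fun z hz => hz.1) (hev'.mono fun z hz => hz.2)
    (hev.mono fun z hz => hz.2.2.1) (hev.mono fun z hz => hz.2.2.2)
  · rw [heq]
    exact (hs.meromorphicAt.mul hs.meromorphicAt).mul hq.meromorphicAt
  · rw [fun_meromorphicOrderAt_inv, L.order_weierstrassP 0 L.lattice.zero_mem]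
    exact le_rfl
  · rw [heq, meromorphicOrderAt_mul (hs.meromorphicAt.mul hs.meromorphicAt) hq.meromorphicAt,
      meromorphicOrderAt_mul hs.meromorphicAt hs.meromorphicAt]
    refine le_trans ?_ (le_add_of_nonneg_right hq.meromorphicOrderAt_nonneg)
    exact le_trans (by norm_num) (add_le_add hs1 hs1)

/-- The relation between `s ^ 2` and `℘`, cleared of denominators, near every point of `U`. -/
theorem eventually_sq_mul_eq (h : IsIVPSolutionOn s c U) (hU : IsOpen U) (hconn : IsConnected U)
    (h0 : 0 ∈ U) {L : PeriodPair} (h2 : L.g₂ = 1) (h3 : L.g₃ = 0) {z : ℂ} (hz : z ∈ U) :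
    ∀ᶠ w in 𝓝[≠] z, s w ^ 2 * (L.weierstrassP w ^ 2 + 1 / 4) = L.weierstrassP w := by
  set F : ℂ → ℂ := fun w => s w ^ 2 * (L.weierstrassP w ^ 2 + 1 / 4) - L.weierstrassP w with hF
  have hmer : MeromorphicOn F U := fun w hw => by
    have hs := (h.analyticAt hU hw).1.meromorphicAt
    have hP := L.meromorphic_weierstrassP w
    fun_prop
  have htop0 : meromorphicOrderAt F 0 = ⊤ := by
    rw [meromorphicOrderAt_eq_top_iff]
    have hev := (h.eventually_hasDerivAt_sq_div hU h0).filter_mono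
      (nhdsWithin_le_nhds (s := {0}ᶜ))
    have hne : ∀ᶠ z in 𝓝[≠] (0 : ℂ), L.weierstrassP z ≠ 0 :=
      (meromorphicOrderAt_ne_top_iff_eventually_ne_zero (L.meromorphic_weierstrassP 0)).1
        (by rw [L.order_weierstrassP 0 L.lattice.zero_mem]; exact WithTop.coe_ne_top)
    filter_upwards [hev, h.eventually_inv_weierstrassP_eq hU h0 h2 h3, hne]
      with w hc hw hPw
    obtain ⟨hc, hsc, -, -⟩ := hc
    have hs : s w ≠ 0 := by
      intro hs
      rw [hs] at hw
      exact inv_ne_zero hPw (by rw [hw]; simp)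
    have hP : L.weierstrassP w = (1 + c w ^ 2) / (2 * s w ^ 2) := by
      rw [← inv_inv (L.weierstrassP w), hw, inv_div]
    simp only [hF, hP]
    field_simp
    linear_combination 4 * hsc
  have htop : meromorphicOrderAt F z = ⊤ := by
    by_contra hne
    exact hmer.meromorphicOrderAt_ne_top_of_isPreconnected hconn.isPreconnected hz h0 hne htop0
  filter_upwards [meromorphicOrderAt_eq_top_iff.1 htop] with w hw
  exact sub_eq_zero.1 hw

theorem sq_eq_of_notMem_lattice (h : IsIVPSolutionOn s c U) (hU : IsOpen U)
    (hconn : IsConnected U) (h0 : 0 ∈ U) {L : PeriodPair} (h2 : L.g₂ = 1) (h3 : L.g₃ = 0) {z : ℂ}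
    (hz : z ∈ U) (hzL : z ∉ L.lattice) :
    L.weierstrassP z ^ 2 + 1 / 4 ≠ 0 ∧
      s z ^ 2 = L.weierstrassP z / (L.weierstrassP z ^ 2 + 1 / 4) := by
  have hs := (h.analyticAt hU hz).1.continuousAt
  have hP := (L.analyticOnNhd_weierstrassP z hzL).continuousAt
  have hF : ContinuousAt (fun w => s w ^ 2 * (L.weierstrassP w ^ 2 + 1 / 4)) z := by fun_prop
  have heq : s z ^ 2 * (L.weierstrassP z ^ 2 + 1 / 4) = L.weierstrassP z :=
    tendsto_nhds_unique_of_eventuallyEq (hF.tendsto.mono_left nhdsWithin_le_nhds)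
      (hP.tendsto.mono_left nhdsWithin_le_nhds)
      (h.eventually_sq_mul_eq hU hconn h0 h2 h3 hz)
  -- If `℘² = -1/4`, the cleared relation would force `℘ = 0`.
  have hne : L.weierstrassP z ^ 2 + 1 / 4 ≠ 0 := by
    intro hne
    rw [hne, mul_zero] at heq
    rw [← heq] at hne
    norm_num at hne
  exact ⟨hne, (eq_div_iff hne).2 heq⟩

theorem sq_eq_zero_of_mem_lattice (h : IsIVPSolutionOn s c U) (hU : IsOpen U)
    (hconn : IsConnected U) (h0 : 0 ∈ U) {L : PeriodPair} (h2 : L.g₂ = 1) (h3 : L.g₃ = 0) {z : ℂ}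
    (hz : z ∈ U) (hzL : z ∈ L.lattice) : s z ^ 2 = 0 := by
  have hord := L.order_weierstrassP z hzL
  have hQ : Tendsto (fun w => (L.weierstrassP w)⁻¹) (𝓝[≠] z) (𝓝 0) := by
    refine tendsto_inv₀_cobounded.comp (tendsto_cobounded_of_meromorphicOrderAt_neg ?_)
    rw [hord]
    exact WithTop.coe_lt_coe.2 (by norm_num)
  have hs : Tendsto s (𝓝[≠] z) (𝓝 (s z)) :=
    (h.analyticAt hU hz).1.continuousAt.tendsto.mono_left nhdsWithin_le_nhds
  have hne : ∀ᶠ w in 𝓝[≠] z, L.weierstrassP w ≠ 0 :=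
    (meromorphicOrderAt_ne_top_iff_eventually_ne_zero (L.meromorphic_weierstrassP z)).1
      (by rw [hord]; exact WithTop.coe_ne_top)
  -- Near a pole the cleared relation is divided by `℘²`, which leaves only the powers of `1/℘`,
  -- tending to `0`.
  have hlim : Tendsto (fun w => s w ^ 2 * (1 + 1 / 4 * (L.weierstrassP w)⁻¹ ^ 2)) (𝓝[≠] z)
      (𝓝 (s z ^ 2 * (1 + 1 / 4 * 0 ^ 2))) :=
    (hs.pow 2).mul (((hQ.pow 2).const_mul _).const_add _)
  have heq : s z ^ 2 * (1 + 1 / 4 * 0 ^ 2) = 0 := by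
    refine tendsto_nhds_unique_of_eventuallyEq hlim hQ ?_
    filter_upwards [h.eventually_sq_mul_eq hU hconn h0 h2 h3 hz, hne] with w hw hPw
    field_simp
    linear_combination 4 * hw
  simpa using heq

end IsIVPSolutionOn

theorem theorem7 :
    -- lattices with invariants 1 and 0 exist
    (∃ L : PeriodPair, L.g₂ = 1 ∧ L.g₃ = 0) ∧
    -- a solution of the initial value problem exists on the disc of radius 4/27
    (∃ s c : ℂ → ℂ, IsIVPSolutionOn s c (Metric.ball 0 (2 ^ 2 / 3 ^ 3))) ∧
    ∀ L : PeriodPair, L.g₂ = 1 → L.g₃ = 0 →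
      -- the right-hand side is an elliptic function
      (Meromorphic (fun z : ℂ => L.weierstrassP z / (L.weierstrassP z ^ 2 + 1 / 4)) ∧
        ∀ l ∈ L.lattice, Function.Periodic
          (fun z : ℂ => L.weierstrassP z / (L.weierstrassP z ^ 2 + 1 / 4)) l) ∧
      -- and it is the square of `s`, wherever a solution of the initial value problem is given;
      -- at the lattice points its singularity is removable, with value 0
      ∀ (U : Set ℂ), IsOpen U → IsConnected U → (0 : ℂ) ∈ U →
        ∀ s c : ℂ → ℂ, IsIVPSolutionOn s c U →
          ∀ z ∈ U,
            (z ∉ L.lattice →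
              L.weierstrassP z ^ 2 + 1 / 4 ≠ 0 ∧
              s z ^ 2 = L.weierstrassP z / (L.weierstrassP z ^ 2 + 1 / 4)) ∧
            (z ∈ L.lattice → s z ^ 2 = 0) := by
  refine ⟨PeriodPair.exists_g₂_eq_one_g₃_eq_zero, exists_isIVPSolutionOn_ball,
    fun L h2 h3 => ⟨⟨?_, ?_⟩, fun U hU hconn h0 s c h z hz =>
      ⟨fun hzL => h.sq_eq_of_notMem_lattice hU hconn h0 h2 h3 hz hzL,
        fun hzL => h.sq_eq_zero_of_mem_lattice hU hconn h0 h2 h3 hz hzL⟩⟩⟩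
  · intro z
    have hP := L.meromorphic_weierstrassP z
    fun_prop
  · intro l hl z
    simp only [L.weierstrassP_add_coe z ⟨l, hl⟩]
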